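/- For a non-integral real number $\alpha>0$ let $\mathrm{PS}(\alpha)=\{\lfloor n^\alpha\rfloor : n=1,2,3,\dots\}$. For all real numbers $2<s<t$, the set of non-integral $\alpha\in[s,t]$ such that $\mathrm{PS}(\alpha)$ contains infinitely many arithmetic progressions of length $3$ (that is, infinitely many sets $\{x,x+d,x+2d\}\subseteq \mathrm{PS}(\alpha)$ with integers $x$ and $d\ge 1$) is uncountable and dense in $[s,t]$. -/

import Mathlib

open Set

/-- The set `PS(α) = {⌊n ^ α⌋ : n = 1, 2, 3, …}` of terms of the Piatetski-Shapiro sequence with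
exponent `α` (used for non-integral `α > 0`). -/
def PS (α : ℝ) : Set ℤ :=
  {m : ℤ | ∃ n : ℕ, 1 ≤ n ∧ m = ⌊(n : ℝ) ^ α⌋}

/-- The set of all `3`-term arithmetic progressions `{x, x + d, x + 2d}` with positive common
difference `d` (so the three terms are pairwise distinct) contained in `A`. -/
def AP3In (A : Set ℤ) : Set (Set ℤ) :=
  {P : Set ℤ | P ⊆ A ∧ ∃ x d : ℤ, 0 < d ∧ P = {x, x + d, x + 2 * d}}

/-- The set of non-integral real `α` such that `PS(α)` contains infinitely many arithmetic
progressions of length `3`. -/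
def exponentsWithInfinitelyManyAP3 : Set ℝ :=
  {α : ℝ | 0 < α ∧ (∀ k : ℤ, α ≠ (k : ℝ)) ∧ (AP3In (PS α)).Infinite}

/-! This is a Baire category argument. For each `K`, the exponents giving a progression of integer
parts that starts at or above `K` form an open set, dense among positive exponents. Intersecting
over `K` and deleting the integers leaves a set residual above 1, hence dense and uncountable in
every interval there. For density, pick `α₀` with `k ^ α₀, m ^ α₀, l ^ α₀` in exact progression.
Scaling by `W` preserves this, and if all fractional parts are small the integer parts are in
progression too. Such a `W` lies within bounded distance of `n ^ α₀`, so a tiny change of exponent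
turns `n ^ α₀` into `W` and barely affects the other factors. -/

/-! ### Almost periods, exact progressions of powers, and dilation -/

/-- Simultaneous almost periods are relatively dense: for finitely many frequencies `θ j`, every
sufficiently long interval contains a point at which all multiples are close to integers. -/
theorem exists_almost_period {ι : Type*} [Fintype ι] (θ : ι → ℝ) {ε : ℝ} (hε : 0 < ε) :
    ∃ B : ℝ, 0 ≤ B ∧ ∀ w : ℝ, ∃ T : ℝ, 0 ≤ T ∧ T ≤ B ∧ ∃ N : ι → ℤ,
      ∀ j, |(w + T) * θ j - N j| < ε := by
  classical
  set g : ℝ → ι → ℤ := fun w j => ⌊Int.fract (w * θ j) / ε⌋ with hg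
  have hfin : (range g).Finite := by
    refine (Set.Finite.pi (fun _ : ι => Set.finite_Icc (0 : ℤ) ⌊1 / ε⌋)).subset ?_
    rintro _ ⟨w, rfl⟩ j -
    refine ⟨Int.floor_nonneg.2 (div_nonneg (Int.fract_nonneg _) hε.le), Int.floor_le_floor ?_⟩
    gcongr
    exact (Int.fract_lt_one _).le
  have hrep : ∀ v : range g, ∃ w, g w = v := fun v => v.2
  choose rep hrep using hrep
  have : Finite (range g) := hfin
  obtain ⟨B, hB⟩ := (Set.finite_range fun v => |rep v|).bddAbove
  have hB' : ∀ v, |rep v| ≤ B := fun v => hB ⟨v, rfl⟩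
  have hB0 : 0 ≤ B := (abs_nonneg _).trans (hB' ⟨g 0, 0, rfl⟩)
  refine ⟨2 * B, by linarith, fun w => ?_⟩
  -- Pigeonhole: `u` and `w + B` lie in the same cell of the torus, so their difference `w + (B -
  -- u)` is an almost period.
  set u := rep ⟨g (w + B), w + B, rfl⟩ with hu
  have hgu : g u = g (w + B) := hrep ⟨g (w + B), w + B, rfl⟩
  have hub := abs_le.1 (hB' ⟨g (w + B), w + B, rfl⟩)
  rw [← hu] at hub
  refine ⟨B - u, by linarith, by linarith, fun j => ⌊(w + B) * θ j⌋ - ⌊u * θ j⌋, fun j => ?_⟩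
  have h1 := Int.abs_sub_lt_one_of_floor_eq_floor (congrFun hgu j)
  rw [← sub_div, abs_div, abs_of_pos hε, div_lt_one hε, abs_sub_comm] at h1
  refine lt_of_eq_of_lt (congrArg _ ?_) h1
  rw [Int.fract, Int.fract]
  push_cast
  ring

/-- Between any two positive exponents there is one for which some three distinct positive
integers have their powers in arithmetic progression. -/
theorem exists_rpow_add_rpow_eq {a b : ℝ} (ha : 0 < a) (hab : a < b) :
    ∃ k m l : ℕ, 0 < k ∧ k < m ∧ m < l ∧ ∃ α ∈ Ioo a b,
      (k : ℝ) ^ α + (l : ℝ) ^ α = 2 * (m : ℝ) ^ α := by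
  have hb : 0 < b := ha.trans hab
  have hua : (0 : ℝ) < (1 / 2 : ℝ) ^ a := by positivity
  have hua1 : (1 / 2 : ℝ) ^ a < 1 := Real.rpow_lt_one (by norm_num) (by norm_num) ha
  have hub1 : (1 / 2 : ℝ) ^ b < 1 := Real.rpow_lt_one (by norm_num) (by norm_num) hb
  have hub : (0 : ℝ) < (1 / 2 : ℝ) ^ b := by positivity
  -- `q ^ a > X` and `q ^ b < Y` force a sign change of `(1/2) ^ α + 1 - 2 * q ^ α`; the strict
  -- power mean inequality leaves room for a rational `q`.
  set X : ℝ := ((1 / 2 : ℝ) ^ a + 1) / 2 with hX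
  set Y : ℝ := ((1 / 2 : ℝ) ^ b + 1) / 2 with hY
  have hX0 : 0 < X := by positivity
  have hY0 : 0 < Y := by positivity
  have hXY : X ^ (b / a) < Y := by
    have hp : 1 < b / a := (one_lt_div ha).2 hab
    have := (strictConvexOn_rpow hp).2 (mem_Ici.2 hua.le) (mem_Ici.2 zero_le_one) hua1.ne
      one_half_pos one_half_pos (add_halves (1 : ℝ))
    simp only [smul_eq_mul, Real.one_rpow] at this
    rw [← Real.rpow_mul (by norm_num : (0 : ℝ) ≤ 1 / 2), mul_div_cancel₀ _ ha.ne'] at this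
    calc X ^ (b / a) = (1 / 2 * (1 / 2 : ℝ) ^ a + 1 / 2 * 1) ^ (b / a) := by rw [hX]; ring_nf
      _ < _ := this
      _ = Y := by rw [hY]; ring
  have hroot : X ^ (1 / a) < Y ^ (1 / b) := by
    have := Real.rpow_lt_rpow (by positivity) hXY (one_div_pos.2 hb)
    rwa [← Real.rpow_mul hX0.le, show b / a * (1 / b) = 1 / a by field_simp] at this
  obtain ⟨q, hq1, hq2⟩ := exists_rat_btwn hroot
  have hq0 : (0 : ℝ) < q := lt_trans (by positivity) hq1
  have hqa : X < (q : ℝ) ^ a := by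
    have := Real.rpow_lt_rpow (by positivity) hq1 ha
    rwa [← Real.rpow_mul hX0.le, one_div_mul_cancel ha.ne', Real.rpow_one] at this
  have hqb : (q : ℝ) ^ b < Y := by
    have := Real.rpow_lt_rpow hq0.le hq2 hb
    rwa [← Real.rpow_mul hY0.le, one_div_mul_cancel hb.ne', Real.rpow_one] at this
  have hqh : (1 / 2 : ℝ) < q := by
    refine (Real.rpow_lt_rpow_iff (by norm_num) hq0.le ha).1 ?_
    linarith
  have hq1' : (q : ℝ) < 1 := by
    refine (Real.rpow_lt_rpow_iff hq0.le (by norm_num) hb).1 ?_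
    rw [Real.one_rpow]
    linarith
  have hcont : Continuous fun α : ℝ => (1 / 2 : ℝ) ^ α + 1 - 2 * (q : ℝ) ^ α :=
    ((Real.continuous_const_rpow (by norm_num)).add continuous_const).sub
      (continuous_const.mul (Real.continuous_const_rpow hq0.ne'))
  obtain ⟨α, hα, hα0⟩ := intermediate_value_Ioo hab.le hcont.continuousOn
    (show (0 : ℝ) ∈ Ioo _ _ from ⟨by linarith, by linarith⟩)
  have hden : (0 : ℝ) < q.den := by exact_mod_cast q.pos
  have hnum : (0 : ℤ) < q.num := Rat.num_pos.2 (by exact_mod_cast hq0)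
  have hn : ((q.num.toNat : ℕ) : ℝ) = q * q.den := by
    have h1 : ((q.num.toNat : ℕ) : ℤ) = q.num := Int.toNat_of_nonneg hnum.le
    have h2 : ((q.num.toNat : ℕ) : ℝ) = (q.num : ℝ) := by exact_mod_cast congrArg (Int.cast (R := ℝ)) h1
    rw [h2]
    exact_mod_cast (Rat.mul_den_eq_num q).symm
  refine ⟨q.den, 2 * q.num.toNat, 2 * q.den, q.pos, ?_, ?_, α, hα, ?_⟩
  · rw [← Nat.cast_lt (α := ℝ)]
    push_cast
    rw [hn]
    nlinarith
  · rw [← Nat.cast_lt (α := ℝ)]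
    push_cast
    rw [hn]
    nlinarith
  · push_cast
    rw [hn, show (q.den : ℝ) = 1 / 2 * (2 * q.den) by ring,
      show 2 * ((q : ℝ) * (1 / 2 * (2 * q.den))) = q * (2 * q.den) by ring,
      show 2 * (1 / 2 * (2 * (q.den : ℝ))) = 2 * q.den by ring,
      Real.mul_rpow (by norm_num) (by positivity), Real.mul_rpow hq0.le (by positivity)]
    linear_combination ((2 * (q.den : ℝ)) ^ α) * hα0

/-- For positive integers `c j` and an exponent `α₀ > 0`, there are a slightly larger exponent `α`
and a dilation `n` such that all `(n * c j) ^ α` have the same integer parts as the numbers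
`W * (c j) ^ α₀`, whose fractional parts lie in `(0, 1 / 4)`; moreover `W` is as large as wanted. -/
theorem exists_dilation_floor {ι : Type*} [Fintype ι] (c : ι → ℕ) (hc : ∀ j, 0 < c j)
    {α₀ δ₀ : ℝ} (hα₀ : 0 < α₀) (hδ₀ : 0 < δ₀) (K : ℝ) :
    ∃ n : ℕ, 0 < n ∧ ∃ α, α₀ ≤ α ∧ α < α₀ + δ₀ ∧ ∃ W, K ≤ W ∧ ∃ N : ι → ℤ, ∀ j,
      (N j < W * (c j : ℝ) ^ α₀ ∧ W * (c j : ℝ) ^ α₀ < N j + 1 / 4) ∧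
      ((N j : ℝ) < ((n * c j : ℕ) : ℝ) ^ α ∧ ((n * c j : ℕ) : ℝ) ^ α < N j + 1) := by
  have hc1 : ∀ j, (1 : ℝ) ≤ c j := fun j => by exact_mod_cast hc j
  have hθ1 : ∀ j, (1 : ℝ) ≤ (c j : ℝ) ^ α₀ := fun j => Real.one_le_rpow (hc1 j) hα₀.le
  have hlog : ∀ j, 0 ≤ Real.log (c j) := fun j => Real.log_nonneg (hc1 j)
  obtain ⟨C, hC1, hC⟩ : ∃ C : ℝ, 1 ≤ C ∧ ∀ j, (c j : ℝ) ^ α₀ ≤ C := by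
    obtain ⟨C, hC⟩ := (Set.finite_range fun j => (c j : ℝ) ^ α₀).bddAbove
    exact ⟨max 1 C, le_max_left _ _, fun j => (hC ⟨j, rfl⟩).trans (le_max_right _ _)⟩
  obtain ⟨D, hD1, hD⟩ : ∃ D : ℝ, 1 ≤ D ∧ ∀ j, Real.log (c j) ≤ D := by
    obtain ⟨D, hD⟩ := (Set.finite_range fun j => Real.log (c j)).bddAbove
    exact ⟨max 1 D, le_max_left _ _, fun j => (hD ⟨j, rfl⟩).trans (le_max_right _ _)⟩
  -- Shifting by `η` beats the error `η / 2`, placing every multiple just above an integer.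
  set η : ℝ := 1 / (16 * C) with hη
  have hη0 : 0 < η := by positivity
  have hηC : η * C = 1 / 16 := by rw [hη]; field_simp
  have hη1 : η ≤ 1 / 16 := by nlinarith
  obtain ⟨B, hB0, hB⟩ := exists_almost_period (fun j => (c j : ℝ) ^ α₀) (half_pos hη0)
  obtain ⟨n, hnL, hnw⟩ : ∃ n : ℕ,
      1 + (B + 1) / δ₀ + 8 * (B + 1) * C * D ≤ Real.log n ∧ |K| + B + 1 ≤ (n : ℝ) ^ α₀ :=
    (((Real.tendsto_log_atTop.comp tendsto_natCast_atTop_atTop).eventually_ge_atTop _).and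
      (((tendsto_rpow_atTop hα₀).comp tendsto_natCast_atTop_atTop).eventually_ge_atTop _)).exists
  set L := Real.log n with hL
  set w := (n : ℝ) ^ α₀ with hw
  have hδ' : 0 < (B + 1) / δ₀ := by positivity
  have hBCD : 0 < 8 * (B + 1) * C * D := by positivity
  have hL1 : 1 ≤ L := by linarith
  have hn0 : 0 < n := by
    rcases Nat.eq_zero_or_pos n with h | h
    · simp [hL, h] at hL1
      linarith
    · exact h
  have hnR : (0 : ℝ) < n := by exact_mod_cast hn0
  have hK := le_abs_self K
  have hK0 := abs_nonneg K
  have hw1 : 1 ≤ w := by linarith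
  have hw0 : 0 < w := by linarith
  obtain ⟨T, hT0, hTB, N, hN⟩ := hB w
  set W := w + T + η with hW
  have hW0 : 0 < W := by linarith
  have hwW : w ≤ W := by linarith
  have hW2 : W ≤ 2 * w := by linarith
  -- Chosen so that `n ^ (α₀ + δ) = W`; a large `log n` makes `δ` small even against `W`.
  set δ := Real.log (W / w) / L with hδ
  have hδ0 : 0 ≤ δ := div_nonneg (Real.log_nonneg ((one_le_div hw0).2 hwW)) (by linarith)
  have hδle : δ ≤ (B + 1) / (w * L) := by
    rw [hδ, ← div_div]
    gcongr
    refine (Real.log_le_sub_one_of_pos (by positivity)).trans ?_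
    rw [div_sub_one hw0.ne']
    gcongr
    linarith
  have hwδ : w * δ * L ≤ B + 1 := by
    rw [le_div_iff₀ (by positivity)] at hδle
    linarith
  have hδL : δ * L ≤ B + 1 := by
    have : 0 ≤ δ * L := by positivity
    nlinarith
  have hnδ : (n : ℝ) ^ δ = W / w := by
    rw [Real.rpow_def_of_pos hnR, ← hL, hδ, mul_div_cancel₀ _ (by linarith : L ≠ 0),
      Real.exp_log (by positivity)]
  have hδD : δ * D * L ≤ (B + 1) * D := by nlinarith
  refine ⟨n, hn0, α₀ + δ, by linarith, ?_, W, by linarith, N, fun j => ?_⟩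
  · have h1 : (B + 1) / δ₀ < L := by linarith
    rw [div_lt_iff₀ hδ₀] at h1
    have : δ * L < δ₀ * L := by linarith
    have := lt_of_mul_lt_mul_right this (by linarith)
    linarith
  · have hj := abs_lt.1 (hN j)
    have hηθ : η ≤ η * (c j : ℝ) ^ α₀ := le_mul_of_one_le_right hη0.le (hθ1 j)
    have hηθ' : η * (c j : ℝ) ^ α₀ ≤ 1 / 16 := hηC ▸ mul_le_mul_of_nonneg_left (hC j) hη0.le
    have hexp : W * (c j : ℝ) ^ α₀ = (w + T) * (c j : ℝ) ^ α₀ + η * (c j : ℝ) ^ α₀ := by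
      rw [hW]; ring
    have hlow : N j < W * (c j : ℝ) ^ α₀ := by linarith
    have hup : W * (c j : ℝ) ^ α₀ < N j + 1 / 4 := by linarith
    have hpow : ((n * c j : ℕ) : ℝ) ^ (α₀ + δ) = W * (c j : ℝ) ^ α₀ * (c j : ℝ) ^ δ := by
      have hcj : (0 : ℝ) < c j := by linarith [hc1 j]
      push_cast
      rw [Real.mul_rpow hnR.le hcj.le, Real.rpow_add hnR, Real.rpow_add hcj, hnδ, ← hw]
      field_simp
    have hcδ1 : (1 : ℝ) ≤ (c j : ℝ) ^ δ := Real.one_le_rpow (hc1 j) hδ0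
    have hsmall : W * (c j : ℝ) ^ α₀ * ((c j : ℝ) ^ δ - 1) ≤ 1 / 2 := by
      have hcj : (0 : ℝ) < c j := by linarith [hc1 j]
      have hx0 : 0 ≤ Real.log (c j) * δ := mul_nonneg (hlog j) hδ0
      have hxD : Real.log (c j) * δ ≤ D * δ := mul_le_mul_of_nonneg_right (hD j) hδ0
      have hBD : (B + 1) * D ≤ 8 * (B + 1) * C * D := by
        have : 0 < (B + 1) * D := by positivity
        nlinarith
      have hx1 : Real.log (c j) * δ ≤ 1 := by
        have : δ * D * L ≤ 1 * L := by linarith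
        have := le_of_mul_le_mul_right this (by linarith)
        linarith
      have hb : (c j : ℝ) ^ δ - 1 ≤ 2 * (D * δ) := by
        rw [Real.rpow_def_of_pos hcj]
        have := Real.abs_exp_sub_one_le (x := Real.log (c j) * δ) (by rwa [abs_of_nonneg hx0])
        rw [abs_of_nonneg hx0] at this
        linarith [le_abs_self (Real.exp (Real.log (c j) * δ) - 1)]
      have h1 : W * (c j : ℝ) ^ α₀ * ((c j : ℝ) ^ δ - 1) ≤ 2 * w * C * (2 * (D * δ)) := by
        have := hC j
        have : (0 : ℝ) ≤ (c j : ℝ) ^ δ - 1 := by linarith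
        gcongr
      refine h1.trans ?_
      have h2 : 4 * C * D * (w * δ * L) ≤ 4 * C * D * (B + 1) := by gcongr
      have h3 : (2 * w * C * (2 * (D * δ))) * L ≤ 1 / 2 * L :=
        calc (2 * w * C * (2 * (D * δ))) * L = 4 * C * D * (w * δ * L) := by ring
          _ ≤ 4 * C * D * (B + 1) := h2
          _ = 1 / 2 * (8 * (B + 1) * C * D) := by ring
          _ ≤ 1 / 2 * L := by linarith
      exact le_of_mul_le_mul_right h3 (by linarith)
    refine ⟨⟨hlow, hup⟩, ?_, ?_⟩
    · rw [hpow]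
      refine hlow.trans_le (le_mul_of_one_le_right ?_ hcδ1)
      have := hθ1 j
      positivity
    · rw [hpow]
      rw [mul_sub_one] at hsmall
      linarith

/-! ### Open dense sets of exponents and Baire category -/

/-- The exponents `α` for which three non-integral powers `x ^ α`, `y ^ α`, `z ^ α` have integer
parts forming an arithmetic progression with first term at least `K`. -/
def exponentsWithAP3Above (K : ℤ) : Set ℝ :=
  {α | ∃ x y z : ℕ, 0 < x ∧ 0 < y ∧ 0 < z ∧ ∃ a d : ℤ, K ≤ a ∧ 0 < d ∧
    (x : ℝ) ^ α ∈ Ioo (a : ℝ) (a + 1) ∧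
    (y : ℝ) ^ α ∈ Ioo ((a + d : ℤ) : ℝ) ((a + d : ℤ) + 1) ∧
    (z : ℝ) ^ α ∈ Ioo ((a + 2 * d : ℤ) : ℝ) ((a + 2 * d : ℤ) + 1)}

/-- Non-integral powers keep their integer parts under small changes of the exponent. -/
theorem isOpen_exponentsWithAP3Above (K : ℤ) : IsOpen (exponentsWithAP3Above K) := by
  have hpow : ∀ x : ℕ, 0 < x → Continuous fun α : ℝ => (x : ℝ) ^ α := fun x hx =>
    Real.continuous_const_rpow (by exact_mod_cast hx.ne')
  rw [isOpen_iff_mem_nhds]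
  rintro α ⟨x, y, z, hx, hy, hz, a, d, ha, hd, h1, h2, h3⟩
  filter_upwards [(hpow x hx).continuousAt.preimage_mem_nhds (isOpen_Ioo.mem_nhds h1),
    (hpow y hy).continuousAt.preimage_mem_nhds (isOpen_Ioo.mem_nhds h2),
    (hpow z hz).continuousAt.preimage_mem_nhds (isOpen_Ioo.mem_nhds h3)] with β g1 g2 g3
  exact ⟨x, y, z, hx, hy, hz, a, d, ha, hd, g1, g2, g3⟩

theorem exists_mem_Ioo_exponentsWithAP3Above (K : ℤ) {a b : ℝ} (ha : 0 < a) (hab : a < b) :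
    ∃ α ∈ Ioo a b, α ∈ exponentsWithAP3Above K := by
  obtain ⟨k, m, l, hk, hkm, hml, α₀, hα₀, heq⟩ := exists_rpow_add_rpow_eq ha hab
  have hα₀0 : 0 < α₀ := ha.trans hα₀.1
  have hk1 : (1 : ℝ) ≤ (k : ℝ) ^ α₀ := Real.one_le_rpow (by exact_mod_cast hk) hα₀0.le
  have hθ : (k : ℝ) ^ α₀ < (m : ℝ) ^ α₀ :=
    Real.rpow_lt_rpow (by positivity) (by exact_mod_cast hkm) hα₀0
  set g := (m : ℝ) ^ α₀ - (k : ℝ) ^ α₀ with hg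
  have hg0 : 0 < g := sub_pos.2 hθ
  obtain ⟨n, hn, α, hα1, hα2, W, hW, N, hN⟩ := exists_dilation_floor ![k, m, l]
    (by
      intro j
      fin_cases j
      · exact hk
      · exact hk.trans hkm
      · exact hk.trans (hkm.trans hml)) hα₀0 (sub_pos.2 hα₀.2) (max (|(K : ℝ)| + 1) (1 / g))
  obtain ⟨⟨x1, x2⟩, hx⟩ := hN 0
  obtain ⟨⟨y1, y2⟩, hy⟩ := hN 1
  obtain ⟨⟨z1, z2⟩, hz⟩ := hN 2
  simp only [Matrix.cons_val_zero, Matrix.cons_val_one, Matrix.cons_val] at x1 x2 y1 y2 z1 z2 hx hy hz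
  have hWK : |(K : ℝ)| + 1 ≤ W := (le_max_left _ _).trans hW
  have hWg : 1 ≤ W * g := (div_le_iff₀ hg0).1 ((le_max_right _ _).trans hW)
  have hsum : W * (k : ℝ) ^ α₀ + W * (l : ℝ) ^ α₀ = 2 * (W * (m : ℝ) ^ α₀) := by
    linear_combination W * heq
  -- The fractional parts are below `1 / 4`, so the integer `N 0 + N 2 - 2 * N 1` has absolute value
  -- below `1 / 2`.
  have hAP : N 0 + N 2 = 2 * N 1 := by
    have h1 : ((N 0 + N 2 : ℤ) : ℝ) < ((2 * N 1 + 1 : ℤ) : ℝ) := by push_cast; linarith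
    have h2 : ((2 * N 1 : ℤ) : ℝ) < ((N 0 + N 2 + 1 : ℤ) : ℝ) := by push_cast; linarith
    have := Int.cast_lt.1 h1
    have := Int.cast_lt.1 h2
    lia
  have hd : N 0 < N 1 := by
    have : (N 0 : ℝ) < N 1 := by
      rw [hg, mul_sub] at hWg
      linarith
    exact_mod_cast this
  have hKN : K ≤ N 0 := by
    have h1 : W ≤ W * (k : ℝ) ^ α₀ :=
      le_mul_of_one_le_right (by linarith [abs_nonneg (K : ℝ)]) hk1
    have : (K : ℝ) ≤ N 0 := by linarith [le_abs_self (K : ℝ)]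
    exact_mod_cast this
  refine ⟨α, ⟨hα₀.1.trans_le hα1, by linarith⟩, n * k, n * m, n * l, by positivity,
    Nat.mul_pos hn (hk.trans hkm), Nat.mul_pos hn (hk.trans (hkm.trans hml)),
    N 0, N 1 - N 0, hKN, by lia, hx, ?_, ?_⟩
  · rw [add_sub_cancel]
    exact hy
  · rw [show N 0 + 2 * (N 1 - N 0) = N 2 by lia]
    exact hz

/-- Finitely many progressions would have a bounded union, contradicting arbitrarily large first
terms. -/
theorem infinite_AP3In_of_forall_mem {α : ℝ} (h : ∀ K : ℕ, α ∈ exponentsWithAP3Above K) :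
    (AP3In (PS α)).Infinite := by
  intro hfin
  have hU : (⋃₀ AP3In (PS α)).Finite := by
    refine hfin.sUnion ?_
    rintro P ⟨-, x, d, -, rfl⟩
    exact Set.toFinite _
  obtain ⟨B, hB⟩ := hU.bddAbove
  obtain ⟨x, y, z, hx, hy, hz, a, d, ha, hd, h1, h2, h3⟩ := h (B.toNat + 1)
  have hPS : ∀ {v : ℕ} {e : ℤ}, 0 < v → (v : ℝ) ^ α ∈ Ioo (e : ℝ) (e + 1) → e ∈ PS α :=
    fun hv he => ⟨_, hv, (Int.floor_eq_iff.2 ⟨he.1.le, he.2⟩).symm⟩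
  have hmem : ({a, a + d, a + 2 * d} : Set ℤ) ∈ AP3In (PS α) := by
    refine ⟨?_, a, d, hd, rfl⟩
    rintro e (rfl | rfl | rfl)
    · exact hPS hx h1
    · exact hPS hy h2
    · exact hPS hz h3
  have := hB (mem_sUnion_of_mem (mem_insert a _) hmem)
  push_cast at ha
  lia

/-- Adjoining `Iio 1` gives density on all of `ℝ`, so Baire's theorem applies without passing to a
subspace. -/
theorem mem_residual_exponentsWithAP3Above (K : ℤ) :
    exponentsWithAP3Above K ∪ Iio 1 ∈ residual ℝ := by
  refine residual_of_dense_open ((isOpen_exponentsWithAP3Above K).union isOpen_Iio) ?_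
  rw [dense_iff_exists_between]
  intro a b hab
  by_cases ha : a < 1
  · obtain ⟨c, hc1, hc2⟩ := exists_between (lt_min hab ha)
    exact ⟨c, Or.inr (hc2.trans_le (min_le_right _ _)), hc1, hc2.trans_le (min_le_left _ _)⟩
  · obtain ⟨c, hc, hcV⟩ := exists_mem_Ioo_exponentsWithAP3Above K
      (zero_lt_one.trans_le (not_lt.1 ha)) hab
    exact ⟨c, Or.inl hcV, hc⟩

theorem Set.Countable.compl_mem_residual {C : Set ℝ} (hC : C.Countable) : Cᶜ ∈ residual ℝ := by
  rw [← biUnion_of_singleton C, compl_iUnion₂]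
  exact (countable_bInter_mem hC).2 fun c _ =>
    residual_of_dense_open isOpen_compl_singleton (dense_compl_singleton c)

theorem exponentsWithInfinitelyManyAP3_union_Iio_mem_residual :
    exponentsWithInfinitelyManyAP3 ∪ Iio 1 ∈ residual ℝ := by
  filter_upwards [countable_iInter_mem.2 fun K : ℕ => mem_residual_exponentsWithAP3Above K,
    (countable_range ((↑) : ℤ → ℝ)).compl_mem_residual] with α h1 h2
  rcases lt_or_ge α 1 with h | h
  · exact Or.inr h
  · refine Or.inl ⟨by linarith, fun k hk => h2 ⟨k, hk.symm⟩, infinite_AP3In_of_forall_mem fun K => ?_⟩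
    exact (mem_iInter.1 h1 K).resolve_right (not_lt.2 h)

theorem corollary3 (s t : ℝ) (hs : 2 < s) (hst : s < t) :
    ¬ (Icc s t ∩ exponentsWithInfinitelyManyAP3).Countable ∧
      Icc s t ⊆ closure (Icc s t ∩ exponentsWithInfinitelyManyAP3) := by
  have hres := exponentsWithInfinitelyManyAP3_union_Iio_mem_residual
  have hmem : ∀ α ∈ Ioo s t, α ∈ exponentsWithInfinitelyManyAP3 ∪ Iio 1 →
      α ∈ Icc s t ∩ exponentsWithInfinitelyManyAP3 := fun α hα h =>
    ⟨Ioo_subset_Icc_self hα, h.resolve_right fun h1 => by linarith [hα.1, mem_Iio.1 h1]⟩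
  constructor
  -- Removing a countable set keeps a residual set residual, so it still meets `Ioo s t`.
  · intro hC
    obtain ⟨α, ⟨h1, h2⟩, hα⟩ := (dense_of_mem_residual
      (Filter.inter_mem hres hC.compl_mem_residual)).exists_mem_open isOpen_Ioo (nonempty_Ioo.2 hst)
    exact h2 (hmem α hα h1)
  · have hsub : Ioo s t ⊆ closure (Icc s t ∩ exponentsWithInfinitelyManyAP3) :=
      ((dense_of_mem_residual hres).open_subset_closure_inter isOpen_Ioo).trans
        (closure_mono fun α h => hmem α h.1 h.2)
    exact (closure_Ioo hst.ne).ge.trans (closure_minimal hsub isClosed_closure)
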